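/- Let $\mathcal A=\left(\frac{-7,-13}{\mathbb Q}\right)$ be the rational quaternion algebra with $\mathbb Q$-basis $1,i,j,k$, where $i^2=-7$, $j^2=-13$ and $k=ij=-ji$, and let $$\mathbb H_{7,13}=\mathbb Z\cdot 1+\mathbb Z\,\tfrac{1+i}{2}+\mathbb Z\,\tfrac{i+k}{7}+\mathbb Z\,\tfrac{7+i+7j+k}{14}\subset\mathcal A .$$ Then $\mathbb H_{7,13}$ is a maximal order of $\mathcal A$, of (reduced) discriminant $13$, and it is a principal ideal domain: it has no zero divisors, every left ideal is of the form $\mathbb H_{7,13}\,\alpha$, and every right ideal is of the form $\alpha\,\mathbb H_{7,13}$, with $\alpha\in\mathbb H_{7,13}$. (An order is a subring that is finitely generated as a $\mathbb Z$-module and spans $\mathcal A$ over $\mathbb Q$; the reduced discriminant is the positive integer $D$ with $D^2=|\det(\operatorname{trd}(e_me_n))|$ for a $\mathbb Z$-basis $e_1,\dots,e_4$ of the order, where $\operatorname{trd}(x)=x+\bar x$.) -/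

import Mathlib

open scoped Quaternion MulOpposite

/-- The rational quaternion algebra `(-7, -13 / ℚ)`: its basis `1, i, j, k` satisfies
`i ^ 2 = -7`, `j ^ 2 = -13` and `k = i * j = -(j * i)`; the element `⟨r, a, b, c⟩` is
`r + a i + b j + c k`. -/
abbrev QuatAlg : Type := ℍ[ℚ, -7, -13]

namespace QuatAlg

/-- `(1 + i) / 2` -/
def v₁ : QuatAlg := ⟨1 / 2, 1 / 2, 0, 0⟩

/-- `(i + k) / 7` -/
def v₂ : QuatAlg := ⟨0, 1 / 7, 0, 1 / 7⟩

/-- `(7 + i + 7 j + k) / 14` -/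
def v₃ : QuatAlg := ⟨1 / 2, 1 / 14, 1 / 2, 1 / 14⟩

/-- The lattice `ℤ + ℤ v₁ + ℤ v₂ + ℤ v₃`. -/
def lattice : Submodule ℤ QuatAlg := Submodule.span ℤ {1, v₁, v₂, v₃}

theorem mem_lattice_iff (x : QuatAlg) :
    x ∈ lattice ↔ ∃ d₀ d₁ d₂ d₃ : ℤ, x = d₀ • (1 : QuatAlg) + d₁ • v₁ + d₂ • v₂ + d₃ • v₃ := by
  simp only [lattice, Submodule.mem_span_insert, Submodule.mem_span_singleton]
  constructor
  · rintro ⟨d₀, _, ⟨d₁, _, ⟨d₂, _, ⟨d₃, rfl⟩, rfl⟩, rfl⟩, rfl⟩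
    exact ⟨d₀, d₁, d₂, d₃, by abel⟩
  · rintro ⟨d₀, d₁, d₂, d₃, rfl⟩
    exact ⟨d₀, _, ⟨d₁, _, ⟨d₂, _, ⟨d₃, rfl⟩, rfl⟩, rfl⟩, by abel⟩

theorem combination_eq (d₀ d₁ d₂ d₃ : ℤ) :
    d₀ • (1 : QuatAlg) + d₁ • v₁ + d₂ • v₂ + d₃ • v₃ =
      ⟨d₀ + d₁ / 2 + d₃ / 2, d₁ / 2 + d₂ / 7 + d₃ / 14, d₃ / 2, d₂ / 7 + d₃ / 14⟩ := by
  ext <;> simp [v₁, v₂, v₃] <;> ring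

theorem mul_mem_lattice {x y : QuatAlg} (hx : x ∈ lattice) (hy : y ∈ lattice) :
    x * y ∈ lattice := by
  rw [mem_lattice_iff] at *
  obtain ⟨p₀, p₁, p₂, p₃, rfl⟩ := hx
  obtain ⟨q₀, q₁, q₂, q₃, rfl⟩ := hy
  refine ⟨p₀ * q₀ - 2 * p₁ * q₁ - p₂ * q₁ - 2 * p₂ * q₂ - p₃ * q₁ - 2 * p₃ * q₂ - 4 * p₃ * q₃,
    p₀ * q₁ + p₁ * q₀ + p₁ * q₁ - 2 * p₂ * q₃ + p₃ * q₁ + 2 * p₃ * q₂,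
    p₀ * q₂ + p₁ * q₂ + 2 * p₁ * q₃ + p₂ * q₀ + p₂ * q₃ - 2 * p₃ * q₁,
    p₀ * q₃ - p₁ * q₂ + p₂ * q₁ + p₃ * q₀ + p₃ * q₁ + p₃ * q₃, ?_⟩
  simp only [combination_eq]
  ext <;> simp <;> ring

/-- The ring `ℤ[1, (1 + i) / 2, (i + k) / 7, (7 + i + 7 j + k) / 14]`: the lattice spanned by
these four elements, which is closed under multiplication. -/
def H : Subring QuatAlg where
  carrier := lattice
  mul_mem' := mul_mem_lattice
  one_mem' := Submodule.subset_span (by simp)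
  add_mem' := lattice.add_mem
  zero_mem' := lattice.zero_mem
  neg_mem' := lattice.neg_mem

/-- An order of the quaternion algebra: a subring that is finitely generated as a `ℤ`-module and
spans the algebra over `ℚ`. -/
def IsOrder (O : Subring QuatAlg) : Prop :=
  Module.Finite ℤ O ∧ Submodule.span ℚ (O : Set QuatAlg) = ⊤

/-- The reduced trace `x + x̄ = 2 re x`, as a rational number. -/
def reducedTrace (x : QuatAlg) : ℚ := (x + star x).re

/-- The order `O` has (reduced) discriminant `D`: for a `ℤ`-basis `e` of `O` (the choice does not
matter), `|det (trd (eₘ eₙ))| = D ^ 2`. -/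
def HasReducedDiscriminant (O : Subring QuatAlg) (D : ℕ) : Prop :=
  ∃ e : Module.Basis (Fin 4) ℤ O,
    |(Matrix.of fun m n : Fin 4 => reducedTrace ((e m : QuatAlg) * (e n : QuatAlg))).det| =
      (D : ℚ) ^ 2

end QuatAlg

/-- A (not necessarily commutative) ring is a left principal ideal domain if it is a domain and
every left ideal is of the form `R a`. -/
def IsLeftPID (R : Type*) [Ring R] : Prop :=
  IsDomain R ∧ ∀ I : Submodule R R, ∃ a : R, I = Submodule.span R {a}

/-- A (not necessarily commutative) ring is a right principal ideal domain if it is a domain and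
every right ideal is of the form `a R`; right ideals are the submodules of `R` for the action of
the opposite ring by right multiplication. -/
def IsRightPID (R : Type*) [Ring R] : Prop :=
  IsDomain R ∧ ∀ I : Submodule Rᵐᵒᵖ R, ∃ a : R, I = Submodule.span Rᵐᵒᵖ {a}

/-! Everything rests on a Dedekind–Hasse property: for `x ∉ H` some `β, γ ∈ H` satisfy `0 < N(βx -
γ) < 1` (`exists_pos_lt_one`). A nonzero element of least norm then generates a left ideal, and
conjugation gives right ideals. An order containing `H` properly would contain such a `βx - γ`,
although nonzero elements of an order have norm at least 1.

For the property, put `ω = (1 + i)/2` and split the algebra as `K ⊕ Kj`, `K = ℚ(i)`. Multiplying by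
some `q ∈ ℤ[ω]` with `N(q) ∣ 4` brings the `Kj`-part within norm `< 3/7` of that of an element of
`H`; translating by `ℤ[ω]` brings the `K`-part within `4/7`. This fails only if the difference is
zero; then `4x ∈ H`, and a finite check on `½H/H` finishes. -/

namespace QuatAlg

/-- The reduced norm `x * star x` of `QuatAlg`, as a rational number. -/
def reducedNorm (x : QuatAlg) : ℚ := x.re ^ 2 + 7 * x.imI ^ 2 + 13 * x.imJ ^ 2 + 91 * x.imK ^ 2

theorem reducedNorm_mul (x y : QuatAlg) :
    reducedNorm (x * y) = reducedNorm x * reducedNorm y := by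
  simp [reducedNorm]; ring

theorem reducedNorm_one : reducedNorm 1 = 1 := by simp [reducedNorm]

theorem reducedNorm_pow (x : QuatAlg) (n : ℕ) : reducedNorm (x ^ n) = reducedNorm x ^ n := by
  induction n with
  | zero => simp [reducedNorm_one]
  | succ n ih => rw [pow_succ, pow_succ, reducedNorm_mul, ih]

theorem reducedNorm_nonneg (x : QuatAlg) : 0 ≤ reducedNorm x := by
  unfold reducedNorm; positivity

theorem reducedNorm_eq_zero {x : QuatAlg} : reducedNorm x = 0 ↔ x = 0 := by
  refine ⟨fun h => ?_, fun h => by simp [h, reducedNorm]⟩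
  unfold reducedNorm at h
  have h1 := sq_nonneg x.re
  have h2 := sq_nonneg x.imI
  have h3 := sq_nonneg x.imJ
  have h4 := sq_nonneg x.imK
  ext
  · exact pow_eq_zero_iff two_ne_zero |>.1 (by linarith)
  · exact pow_eq_zero_iff two_ne_zero |>.1 (by linarith)
  · exact pow_eq_zero_iff two_ne_zero |>.1 (by linarith)
  · exact pow_eq_zero_iff two_ne_zero |>.1 (by linarith)

theorem reducedNorm_pos {x : QuatAlg} : 0 < reducedNorm x ↔ x ≠ 0 := by
  rw [(reducedNorm_nonneg x).lt_iff_ne, ne_comm, Ne, reducedNorm_eq_zero]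

theorem reducedNorm_zsmul (n : ℤ) (x : QuatAlg) :
    reducedNorm (n • x) = (n : ℚ) ^ 2 * reducedNorm x := by
  simp [reducedNorm]; ring

theorem mem_H_iff (x : QuatAlg) :
    x ∈ H ↔ ∃ d₀ d₁ d₂ d₃ : ℤ, x =
      ⟨d₀ + d₁ / 2 + d₃ / 2, d₁ / 2 + d₂ / 7 + d₃ / 14, d₃ / 2, d₂ / 7 + d₃ / 14⟩ := by
  simp only [← combination_eq]
  exact mem_lattice_iff x

theorem star_mem_H {x : QuatAlg} (hx : x ∈ H) : star x ∈ H := by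
  rw [mem_H_iff] at *
  obtain ⟨a, b, c, d, rfl⟩ := hx
  refine ⟨a + b + d, -b, -c, -d, ?_⟩
  ext <;> simp <;> ring

theorem exists_reducedNorm_eq_natCast {x : QuatAlg} (hx : x ∈ H) :
    ∃ n : ℕ, reducedNorm x = n := by
  have key : ∃ n : ℤ, reducedNorm x = n := by
    obtain ⟨a, b, c, d, rfl⟩ := (mem_H_iff x).1 hx
    refine ⟨a ^ 2 + 2 * b ^ 2 + 2 * c ^ 2 + 4 * d ^ 2 + a * b + a * d + b * c + b * d + 2 * c * d,
      ?_⟩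
    simp only [reducedNorm]; push_cast; ring
  obtain ⟨n, hn⟩ := key
  have h0 : 0 ≤ n := by
    have := reducedNorm_nonneg x
    rw [hn] at this
    exact_mod_cast this
  lift n to ℕ using h0
  exact ⟨n, by simpa using hn⟩

/-! ### Covering by disks -/

/-- The disks have centres `p/q` = `0`, `1/2`, `(3 + i)/8`, `(1 + i)/4` and squared radius `3/(13
N(q))`, with `N(q)` = 1, 4, 4, 2. -/
theorem disks_cover_quarter_box {x y : ℚ} (hx0 : 0 ≤ x) (hx : x ≤ 1 / 2) (hy0 : 0 ≤ y)
    (hy : y ≤ 1 / 4) :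
    x ^ 2 + 7 * y ^ 2 < 3 / 13 ∨ 4 * ((x - 1 / 2) ^ 2 + 7 * y ^ 2) < 3 / 13 ∨
      4 * ((x - 3 / 8) ^ 2 + 7 * (y - 1 / 8) ^ 2) < 3 / 13 ∨
      2 * ((x - 1 / 4) ^ 2 + 7 * (y - 1 / 4) ^ 2) < 3 / 13 := by
  rcases le_total y (3 / 40) with h1 | h1
  · rcases le_total x (11 / 30) with h2 | h2
    · left
      nlinarith [mul_nonneg hx0 (sub_nonneg.2 h2), mul_nonneg hy0 (sub_nonneg.2 h1)]
    · right; left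
      nlinarith [mul_nonneg (sub_nonneg.2 h2) (sub_nonneg.2 hx),
        mul_nonneg hy0 (sub_nonneg.2 h1)]
  · rcases le_total y (1 / 6) with h3 | h3
    · rcases le_total x (11 / 60) with h2 | h2
      · left
        nlinarith [mul_nonneg hx0 (sub_nonneg.2 h2),
          mul_nonneg (sub_nonneg.2 h1) (sub_nonneg.2 h3)]
      · right; right; left
        nlinarith [mul_nonneg (sub_nonneg.2 h2) (sub_nonneg.2 hx),
          mul_nonneg (sub_nonneg.2 h1) (sub_nonneg.2 h3)]
    · right; right; right
      nlinarith [mul_nonneg hx0 (sub_nonneg.2 hx), mul_nonneg (sub_nonneg.2 h3) (sub_nonneg.2 hy)]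

/-- Every rational `x + y i` lies in the box `|re| ≤ 1 / 2`, `|im| ≤ 1 / 4` up to an element
`m + n (1 + i) / 2`. -/
theorem exists_abs_sub_le (x y : ℚ) :
    ∃ m n : ℤ, |x - (m + n / 2)| ≤ 1 / 2 ∧ |y - n / 2| ≤ 1 / 4 := by
  refine ⟨round (x - round (2 * y) / 2), round (2 * y), ?_, ?_⟩
  · have := abs_sub_round (x - (round (2 * y) : ℚ) / 2)
    rwa [sub_sub, add_comm] at this
  · have := abs_sub_round (2 * y)
    rw [abs_le] at *
    constructor <;> linarith [this.1, this.2]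

theorem exists_approx_box {x y : ℚ} (hx : |x| ≤ 1 / 2) (hy : |y| ≤ 1 / 4) :
    ∃ q₀ q₁ p₀ p₁ : ℤ, q₀ ^ 2 + q₀ * q₁ + 2 * q₁ ^ 2 ∣ 4 ∧
      ((q₀ + q₁ / 2) * x - 7 * (q₁ / 2) * y - (p₀ + p₁ / 2)) ^ 2 +
        7 * ((q₀ + q₁ / 2) * y + q₁ / 2 * x - p₁ / 2) ^ 2 < (3 / 13 : ℚ) := by
  rcases disks_cover_quarter_box (abs_nonneg x) hx (abs_nonneg y) hy with h | h | h | h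
  · refine ⟨1, 0, 0, 0, by norm_num, ?_⟩
    rw [sq_abs, sq_abs] at h
    push_cast; linarith
  -- In each case `p/q` is the disk centre reflected into the quadrant of `x + yi`.
  · rcases abs_cases x with ⟨hx', -⟩ | ⟨hx', -⟩ <;> rw [hx', sq_abs] at h
    · refine ⟨2, 0, 1, 0, by norm_num, ?_⟩
      push_cast; linarith
    · refine ⟨2, 0, -1, 0, by norm_num, ?_⟩
      push_cast; linarith
  · rcases abs_cases x with ⟨hx', -⟩ | ⟨hx', -⟩ <;>
      rcases abs_cases y with ⟨hy', -⟩ | ⟨hy', -⟩ <;> rw [hx', hy'] at h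
    · refine ⟨-2, 1, -1, 0, by norm_num, ?_⟩
      push_cast; linarith
    · refine ⟨-1, -1, -1, 0, by norm_num, ?_⟩
      push_cast; linarith
    · refine ⟨-1, -1, 1, 0, by norm_num, ?_⟩
      push_cast; linarith
    · refine ⟨-2, 1, 1, 0, by norm_num, ?_⟩
      push_cast; linarith
  · rcases abs_cases x with ⟨hx', -⟩ | ⟨hx', -⟩ <;>
      rcases abs_cases y with ⟨hy', -⟩ | ⟨hy', -⟩ <;> rw [hx', hy'] at h
    · refine ⟨1, -1, 1, 0, by norm_num, ?_⟩
      push_cast; linarith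
    · refine ⟨0, 1, 1, 0, by norm_num, ?_⟩
      push_cast; linarith
    · refine ⟨0, 1, -1, 0, by norm_num, ?_⟩
      push_cast; linarith
    · refine ⟨1, -1, -1, 0, by norm_num, ?_⟩
      push_cast; linarith

theorem exists_approx (x y : ℚ) :
    ∃ q₀ q₁ p₀ p₁ : ℤ, q₀ ^ 2 + q₀ * q₁ + 2 * q₁ ^ 2 ∣ 4 ∧
      ((q₀ + q₁ / 2) * x - 7 * (q₁ / 2) * y - (p₀ + p₁ / 2)) ^ 2 +
        7 * ((q₀ + q₁ / 2) * y + q₁ / 2 * x - p₁ / 2) ^ 2 < (3 / 13 : ℚ) := by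
  obtain ⟨m, n, hm, hn⟩ := exists_abs_sub_le x y
  obtain ⟨q₀, q₁, p₀, p₁, hq, h⟩ := exists_approx_box hm hn
  -- Adds `(q₀ + q₁ω)(m + nω)` to `p`, using `ω² = ω - 2`.
  refine ⟨q₀, q₁, p₀ + (q₀ * m - 2 * q₁ * n), p₁ + (q₀ * n + q₁ * m + q₁ * n), hq, ?_⟩
  push_cast
  convert h using 1
  ring

/-- `4/7` is the squared covering radius of `ℤ[ω]`: the triangle `0, 1, ω` has circumcentre `1/2 +
(3/14)i`. In the box, a point too far from `0` is close to one of the `(±1 ± i)/2`. -/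
theorem exists_sq_add_le (x y : ℚ) :
    ∃ m n : ℤ, (x - (m + n / 2)) ^ 2 + 7 * (y - n / 2) ^ 2 ≤ 4 / 7 := by
  obtain ⟨m, n, hm, hn⟩ := exists_abs_sub_le x y
  set u := x - (m + n / 2) with hu
  set v := y - n / 2 with hv
  by_cases h : u ^ 2 + 7 * v ^ 2 ≤ 4 / 7
  · exact ⟨m, n, h⟩
  push Not at h
  have key : (|u| - 1 / 2) ^ 2 + 7 * (|v| - 1 / 2) ^ 2 ≤ 4 / 7 := by
    rw [← sq_abs u, ← sq_abs v] at h
    nlinarith [mul_nonneg (abs_nonneg u) (sub_nonneg.2 hm),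
      mul_nonneg (abs_nonneg v) (sub_nonneg.2 hn)]
  rcases abs_cases u with ⟨hu', -⟩ | ⟨hu', -⟩ <;>
    rcases abs_cases v with ⟨hv', -⟩ | ⟨hv', -⟩ <;> rw [hu', hv', hu, hv] at key
  · refine ⟨m, n + 1, ?_⟩
    push_cast; linarith
  · refine ⟨m + 1, n - 1, ?_⟩
    push_cast; linarith
  · refine ⟨m - 1, n + 1, ?_⟩
    push_cast; linarith
  · refine ⟨m, n - 1, ?_⟩
    push_cast; linarith

/-! ### The Dedekind–Hasse property -/

theorem exists_reducedNorm_lt_one (x : QuatAlg) :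
    ∃ q ∈ H, ∃ r ∈ H, ∃ γ ∈ H, r * q = ⟨4, 0, 0, 0⟩ ∧ reducedNorm (q * x - γ) < 1 := by
  -- The `Kj`-part is `wj`, and `-iw = 7 imK - imJ·i`. In this coordinate `H` projects onto `ℤ[ω]`
  -- and the norm `13 N(w)` becomes `13/7` of the norm, so `3/13` yields `3/7`.
  obtain ⟨q₀, q₁, p₀, p₁, ⟨e, he⟩, h⟩ := exists_approx (7 * x.imK) (-x.imJ)
  set q : QuatAlg := ⟨q₀ + q₁ / 2, q₁ / 2, 0, 0⟩ with hq
  -- A lift to `H` of `p₀ + p₁ω`, namely `(p₀ + p₁)v₂ - p₁v₃`.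
  set p : QuatAlg := ⟨-(p₁ / 2), (p₀ + p₁ / 2) / 7, -(p₁ / 2), (p₀ + p₁ / 2) / 7⟩ with hp
  obtain ⟨m, n, hmn⟩ := exists_sq_add_le (q * x - p).re (q * x - p).imI
  refine ⟨q, (mem_H_iff _).2 ⟨q₀, q₁, 0, 0, by ext <;> simp [hq]⟩,
    -- `r = e q̄` with `e = 4/N(q)`.
    ⟨e * (q₀ + q₁ / 2), -(e * (q₁ / 2)), 0, 0⟩,
    (mem_H_iff _).2 ⟨e * (q₀ + q₁), -(e * q₁), 0, 0, by ext <;> simp <;> ring⟩,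
    p + ⟨m + n / 2, n / 2, 0, 0⟩,
    (mem_H_iff _).2 ⟨m, n, p₀ + p₁, -p₁, by ext <;> simp [hp] <;> ring⟩, ?_, ?_⟩
  · have he' : ((q₀ : ℚ) ^ 2 + q₀ * q₁ + 2 * q₁ ^ 2) * e = 4 := by exact_mod_cast he.symm
    ext <;> simp [hq]
    · linarith
    · ring
  · have h1 : (q * x - p).imK = ((q₀ + q₁ / 2) * (7 * x.imK) - 7 * (q₁ / 2) * -x.imJ
        - (p₀ + p₁ / 2)) / 7 := by simp [hq, hp]; ring
    have h2 : (q * x - p).imJ = -((q₀ + q₁ / 2) * -x.imJ + q₁ / 2 * (7 * x.imK) - p₁ / 2) := by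
      simp [hq, hp]; ring
    have h3 : reducedNorm (q * x - (p + ⟨m + n / 2, n / 2, 0, 0⟩)) =
        ((q * x - p).re - (m + n / 2)) ^ 2 + 7 * ((q * x - p).imI - n / 2) ^ 2 +
          13 * (q * x - p).imJ ^ 2 + 91 * (q * x - p).imK ^ 2 := by
      rw [← sub_sub]
      generalize q * x - p = z
      simp [reducedNorm]
    rw [h3, h1, h2]
    linarith

theorem zsmul_eq (n : ℤ) (x : QuatAlg) :
    n • x = ⟨n * x.re, n * x.imI, n * x.imJ, n * x.imK⟩ := by
  ext <;> simp

theorem exists_pos_lt_one_of_two_zsmul_mem {x : QuatAlg} (hx : x ∉ H) (h2 : (2 : ℤ) • x ∈ H) :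
    ∃ β ∈ H, ∃ γ ∈ H, 0 < reducedNorm (β * x - γ) ∧ reducedNorm (β * x - γ) < 1 := by
  obtain ⟨d₀, d₁, d₂, d₃, h⟩ := (mem_H_iff _).1 h2
  obtain ⟨n₀, hn₀⟩ := Int.even_or_odd' d₀
  obtain ⟨n₁, hn₁⟩ := Int.even_or_odd' d₁
  obtain ⟨n₂, hn₂⟩ := Int.even_or_odd' d₂
  obtain ⟨n₃, hn₃⟩ := Int.even_or_odd' d₃
  obtain ⟨e₀, he₀⟩ : ∃ e₀ : ℤ, d₀ = 2 * n₀ + e₀ := ⟨d₀ - 2 * n₀, by ring⟩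
  obtain ⟨e₁, he₁⟩ : ∃ e₁ : ℤ, d₁ = 2 * n₁ + e₁ := ⟨d₁ - 2 * n₁, by ring⟩
  obtain ⟨e₂, he₂⟩ : ∃ e₂ : ℤ, d₂ = 2 * n₂ + e₂ := ⟨d₂ - 2 * n₂, by ring⟩
  obtain ⟨e₃, he₃⟩ : ∃ e₃ : ℤ, d₃ = 2 * n₃ + e₃ := ⟨d₃ - 2 * n₃, by ring⟩
  set z : QuatAlg := ⟨n₀ + n₁ / 2 + n₃ / 2, n₁ / 2 + n₂ / 7 + n₃ / 14, n₃ / 2, n₂ / 7 + n₃ / 14⟩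
    with hz
  set t : QuatAlg := ⟨(e₀ + e₁ / 2 + e₃ / 2) / 2, (e₁ / 2 + e₂ / 7 + e₃ / 14) / 2, e₃ / 2 / 2,
    (e₂ / 7 + e₃ / 14) / 2⟩ with ht
  have hzH : z ∈ H := (mem_H_iff _).2 ⟨n₀, n₁, n₂, n₃, rfl⟩
  have hxt : x = z + t := by
    subst he₀ he₁ he₂ he₃
    rw [zsmul_eq, QuaternionAlgebra.ext_iff] at h
    push_cast at h
    obtain ⟨h0, h1, h2, h3⟩ := h
    ext <;> simp [hz, ht] <;> linarith
  -- Only the class `t` of `x` modulo `H` matters, since `βz` can be absorbed into `γ`.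
  have key : ∀ b₀ b₁ b₂ b₃ g₀ g₁ g₂ g₃ : ℤ,
      0 < reducedNorm (⟨b₀ + b₁ / 2 + b₃ / 2, b₁ / 2 + b₂ / 7 + b₃ / 14, b₃ / 2,
        b₂ / 7 + b₃ / 14⟩ * t - ⟨g₀ + g₁ / 2 + g₃ / 2, g₁ / 2 + g₂ / 7 + g₃ / 14, g₃ / 2,
        g₂ / 7 + g₃ / 14⟩) →
      reducedNorm (⟨b₀ + b₁ / 2 + b₃ / 2, b₁ / 2 + b₂ / 7 + b₃ / 14, b₃ / 2,
        b₂ / 7 + b₃ / 14⟩ * t - ⟨g₀ + g₁ / 2 + g₃ / 2, g₁ / 2 + g₂ / 7 + g₃ / 14, g₃ / 2,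
        g₂ / 7 + g₃ / 14⟩) < 1 →
      ∃ β ∈ H, ∃ γ ∈ H, 0 < reducedNorm (β * x - γ) ∧ reducedNorm (β * x - γ) < 1 := by
    intro b₀ b₁ b₂ b₃ g₀ g₁ g₂ g₃ hpos hlt
    have hb := (mem_H_iff _).2 ⟨b₀, b₁, b₂, b₃, rfl⟩
    have hg := (mem_H_iff _).2 ⟨g₀, g₁, g₂, g₃, rfl⟩
    refine ⟨_, hb, _, H.add_mem (H.mul_mem hb hzH) hg, ?_⟩
    rw [hxt, mul_add, add_sub_add_left_eq_sub]
    exact ⟨hpos, hlt⟩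
  have h0 : e₀ = 0 ∨ e₀ = 1 := by omega
  have h1 : e₁ = 0 ∨ e₁ = 1 := by omega
  have h2 : e₂ = 0 ∨ e₂ = 1 := by omega
  have h3 : e₃ = 0 ∨ e₃ = 1 := by omega
  clear he₀ he₁ he₂ he₃ hn₀ hn₁ hn₂ hn₃
  -- The sixteen classes of `½H/H`: the zero class contradicts `x ∉ H`; each other class has
  -- explicit coordinates of `β` and `γ`.
  rcases h0 with rfl | rfl <;> rcases h1 with rfl | rfl <;> rcases h2 with rfl | rfl <;>
    rcases h3 with rfl | rfl <;> norm_num at ht <;> rw [ht] at key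
  · refine absurd ?_ hx
    rw [hxt, ht]
    convert hzH
    ext <;> simp
  · exact key 0 0 1 0 0 (-1) 0 0 (by norm_num [reducedNorm]) (by norm_num [reducedNorm])
  · exact key 1 0 0 0 0 0 0 0 (by norm_num [reducedNorm]) (by norm_num [reducedNorm])
  · exact key 0 0 1 0 (-1) (-1) 0 0 (by norm_num [reducedNorm]) (by norm_num [reducedNorm])
  · exact key 0 1 0 0 (-1) 0 0 0 (by norm_num [reducedNorm]) (by norm_num [reducedNorm])
  · exact key 0 0 0 1 (-2) 0 (-1) 1 (by norm_num [reducedNorm]) (by norm_num [reducedNorm])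
  · exact key 1 0 0 0 0 0 1 0 (by norm_num [reducedNorm]) (by norm_num [reducedNorm])
  · exact key 0 1 1 0 (-2) (-1) 2 0 (by norm_num [reducedNorm]) (by norm_num [reducedNorm])
  · exact key 0 0 1 0 0 0 0 0 (by norm_num [reducedNorm]) (by norm_num [reducedNorm])
  · exact key 0 1 0 0 0 0 1 0 (by norm_num [reducedNorm]) (by norm_num [reducedNorm])
  · exact key 0 0 1 0 (-1) 0 0 0 (by norm_num [reducedNorm]) (by norm_num [reducedNorm])
  · exact key 1 1 0 0 0 1 2 0 (by norm_num [reducedNorm]) (by norm_num [reducedNorm])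
  · exact key 0 0 0 1 0 0 (-1) 1 (by norm_num [reducedNorm]) (by norm_num [reducedNorm])
  · exact key 1 0 1 0 0 0 1 1 (by norm_num [reducedNorm]) (by norm_num [reducedNorm])
  · exact key 0 0 0 1 (-1) 1 (-1) 1 (by norm_num [reducedNorm]) (by norm_num [reducedNorm])
  · exact key 0 1 1 0 (-2) 0 2 0 (by norm_num [reducedNorm]) (by norm_num [reducedNorm])

/-- The Dedekind–Hasse property of `H`. -/
theorem exists_pos_lt_one {x : QuatAlg} (hx : x ∉ H) :
    ∃ β ∈ H, ∃ γ ∈ H, 0 < reducedNorm (β * x - γ) ∧ reducedNorm (β * x - γ) < 1 := by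
  obtain ⟨q, hq, r, hr, γ, hγ, hrq, hlt⟩ := exists_reducedNorm_lt_one x
  by_cases h0 : q * x - γ = 0
  · have h4 : (4 : ℤ) • x ∈ H := by
      have : (4 : ℤ) • x = r * γ := by
        rw [← sub_eq_zero.1 h0, ← mul_assoc, hrq, zsmul_eq]
        ext <;> simp
      exact this ▸ H.mul_mem hr hγ
    by_cases h2 : (2 : ℤ) • x ∈ H
    · exact exists_pos_lt_one_of_two_zsmul_mem hx h2
    -- Here `2x` is the element of `½H` outside `H`, and the factor 2 moves into `β`.
    · obtain ⟨β, hβ, γ', hγ', h⟩ := exists_pos_lt_one_of_two_zsmul_mem h2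
        (by rwa [smul_smul])
      refine ⟨(2 : ℤ) • β, H.zsmul_mem hβ 2, γ', hγ', ?_⟩
      rwa [smul_mul_assoc, ← mul_smul_comm]
  · exact ⟨q, hq, γ, hγ, reducedNorm_pos.2 h0, hlt⟩

/-! ### Principal ideals -/

theorem exists_mul_eq {a : QuatAlg} (ha : a ≠ 0) (b : QuatAlg) : ∃ x, x * a = b := by
  have h : reducedNorm a ≠ 0 := (reducedNorm_pos.2 ha).ne'
  refine ⟨b * ((reducedNorm a)⁻¹ • star a), ?_⟩
  have : (reducedNorm a)⁻¹ • star a * a = 1 := by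
    have h1 : star a * a = reducedNorm a • 1 := by
      ext <;> simp [reducedNorm] <;> ring
    rw [smul_mul_assoc, h1, smul_smul, inv_mul_cancel₀ h, one_smul]
  rw [mul_assoc, this, mul_one]

/-- Stated for subgroups of the algebra so that it also applies to the conjugate of a right ideal.
If `xa ∈ L` with `a` of least norm and `x ∉ H`, then `(βx - γ)a ∈ L` is nonzero of smaller norm. -/
theorem exists_generator (L : AddSubgroup QuatAlg) (hL : ∀ x ∈ L, x ∈ H)
    (hmul : ∀ c ∈ H, ∀ x ∈ L, c * x ∈ L) :
    ∃ a ∈ L, ∀ b ∈ L, ∃ c ∈ H, b = c * a := by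
  classical
  by_cases h : ∃ x ∈ L, x ≠ 0
  · have hex : ∃ n : ℕ, ∃ x ∈ L, x ≠ 0 ∧ reducedNorm x = n := by
      obtain ⟨x, hx, hx0⟩ := h
      obtain ⟨n, hn⟩ := exists_reducedNorm_eq_natCast (hL x hx)
      exact ⟨n, x, hx, hx0, hn⟩
    obtain ⟨a, ha, ha0, hna⟩ := Nat.find_spec hex
    refine ⟨a, ha, fun b hb => ?_⟩
    obtain ⟨x, rfl⟩ := exists_mul_eq ha0 b
    refine ⟨x, ?_, rfl⟩
    by_contra hx
    obtain ⟨β, hβ, γ, hγ, hpos, hlt⟩ := exists_pos_lt_one hx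
    have hmem : (β * x - γ) * a ∈ L := by
      rw [sub_mul, mul_assoc]
      exact L.sub_mem (hmul β hβ _ hb) (hmul γ hγ _ ha)
    have hapos := reducedNorm_pos.2 ha0
    obtain ⟨n, hn⟩ := exists_reducedNorm_eq_natCast (hL _ hmem)
    have hn0 : (β * x - γ) * a ≠ 0 := by
      rw [← reducedNorm_pos, reducedNorm_mul]
      exact mul_pos hpos hapos
    refine Nat.find_min hex (m := n) ?_ ⟨_, hmem, hn0, hn⟩
    have : reducedNorm ((β * x - γ) * a) < reducedNorm a := by
      rw [reducedNorm_mul]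
      exact mul_lt_of_lt_one_left hapos hlt
    rw [hn, hna] at this
    exact_mod_cast this
  · push Not at h
    exact ⟨0, L.zero_mem, fun b hb => ⟨0, H.zero_mem, by rw [h b hb, zero_mul]⟩⟩

instance : NoZeroDivisors QuatAlg where
  eq_zero_or_eq_zero_of_mul_eq_zero {a b} h := by
    rw [← reducedNorm_eq_zero, reducedNorm_mul, mul_eq_zero] at h
    simpa only [reducedNorm_eq_zero] using h

theorem isDomain_H : IsDomain H :=
  have : NoZeroDivisors H := Subtype.coe_injective.noZeroDivisors H.subtype (map_zero _)
    (map_mul _)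
  NoZeroDivisors.to_isDomain H

theorem isLeftPID_H : IsLeftPID H := by
  refine ⟨isDomain_H, fun I => ?_⟩
  obtain ⟨a, ⟨a, ha, rfl⟩, h⟩ := exists_generator (I.toAddSubgroup.map (H.subtype : H →+ QuatAlg))
    (by rintro _ ⟨x, -, rfl⟩; exact x.2)
    (by rintro c hc _ ⟨x, hx, rfl⟩; exact ⟨⟨c, hc⟩ * x, I.smul_mem ⟨c, hc⟩ hx, rfl⟩)
  refine ⟨a, le_antisymm (fun b hb => ?_) ((Submodule.span_singleton_le_iff_mem _ _).2 ha)⟩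
  obtain ⟨c, hc, hb'⟩ := h b ⟨b, hb, rfl⟩
  exact Submodule.mem_span_singleton.2 ⟨⟨c, hc⟩, Subtype.ext hb'.symm⟩

theorem isRightPID_H : IsRightPID H := by
  refine ⟨isDomain_H, fun I => ?_⟩
  obtain ⟨a, ⟨a, ha, rfl⟩, h⟩ := exists_generator
    (I.toAddSubgroup.map ((starAddEquiv : QuatAlg ≃+ QuatAlg).toAddMonoidHom.comp
      (H.subtype : H →+ QuatAlg)))
    (by rintro _ ⟨x, -, rfl⟩; exact star_mem_H x.2)
    (by
      rintro c hc _ ⟨x, hx, rfl⟩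
      exact ⟨x * ⟨star c, star_mem_H hc⟩, I.smul_mem (MulOpposite.op ⟨star c, star_mem_H hc⟩) hx, by simp⟩)
  refine ⟨a, le_antisymm (fun b hb => ?_) ((Submodule.span_singleton_le_iff_mem _ _).2 ha)⟩
  obtain ⟨c, hc, hb'⟩ := h (star b) ⟨b, hb, rfl⟩
  refine Submodule.mem_span_singleton.2 ⟨MulOpposite.op ⟨star c, star_mem_H hc⟩, Subtype.ext ?_⟩
  have := congrArg star hb'
  simpa using this.symm

/-! ### Discriminant and maximality -/

/-- The `ℤ`-basis `1, v₁, v₂, v₃` of `H`. -/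
noncomputable def basisH : Module.Basis (Fin 4) ℤ H :=
  Module.Basis.mk (v := ![1, ⟨v₁, Submodule.subset_span (by simp)⟩,
      ⟨v₂, Submodule.subset_span (by simp)⟩, ⟨v₃, Submodule.subset_span (by simp)⟩])
    (by
      rw [Fintype.linearIndependent_iff]
      intro g hg
      have h := congrArg (Subtype.val : H → QuatAlg) hg
      simp only [Fin.sum_univ_four] at h
      change g 0 • (1 : QuatAlg) + g 1 • v₁ + g 2 • v₂ + g 3 • v₃ = 0 at h
      rw [combination_eq, QuaternionAlgebra.ext_iff] at h
      simp at h
      obtain ⟨h0, h1, h2, h3⟩ := h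
      have e3 : (g 3 : ℚ) = 0 := by exact_mod_cast h2
      have e2 : (g 2 : ℚ) = 0 := by linarith
      have e1 : (g 1 : ℚ) = 0 := by linarith
      have e0 : (g 0 : ℚ) = 0 := by linarith
      intro i
      fin_cases i
      · exact_mod_cast e0
      · exact_mod_cast e1
      · exact_mod_cast e2
      · exact_mod_cast e3)
    (by
      rintro ⟨x, hx⟩ -
      obtain ⟨d₀, d₁, d₂, d₃, rfl⟩ := (mem_lattice_iff x).1 hx
      rw [Submodule.mem_span_range_iff_exists_fun]
      refine ⟨![d₀, d₁, d₂, d₃], Subtype.ext ?_⟩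
      simp only [Fin.sum_univ_four]
      rfl)

theorem coe_basisH (m : Fin 4) : (basisH m : QuatAlg) = ![1, v₁, v₂, v₃] m := by
  fin_cases m <;> simp [basisH]

theorem hasReducedDiscriminant_H : HasReducedDiscriminant H 13 := by
  refine ⟨basisH, ?_⟩
  have : (Matrix.of fun m n : Fin 4 =>
      reducedTrace ((basisH m : QuatAlg) * (basisH n : QuatAlg))) =
      !![2, 1, 0, 1; 1, -3, -1, 0; 0, -1, -4, -2; 1, 0, -2, -7] := by
    ext m n
    fin_cases m <;> fin_cases n <;> norm_num [coe_basisH, reducedTrace, v₁, v₂, v₃]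
  rw [this]
  have h1 : Fin.succAbove (1 : Fin 4) 2 = 3 := rfl
  have h3 : Fin.succAbove (3 : Fin 4) 2 = 2 := rfl
  simp [Matrix.det_succ_row_zero, Fin.sum_univ_succ, h1, h3]
  norm_num

theorem exists_zsmul_mem_H (x : QuatAlg) : ∃ D : ℤ, D ≠ 0 ∧ D • x ∈ H := by
  obtain ⟨a, b, c, d⟩ := x
  refine ⟨14 * (a.den * b.den * c.den * d.den), by simp, (mem_H_iff _).2 ?_⟩
  have hN : ∀ r : ℚ, (r.den : ℚ) * r = r.num := Rat.den_mul_eq_num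
  have hA : (14 * (a.den * b.den * c.den * d.den)) * a =
      14 * ((b.den * c.den * d.den : ℤ) * a.num : ℤ) := by push_cast; rw [← hN a]; ring
  have hB : (14 * (a.den * b.den * c.den * d.den)) * b =
      14 * ((a.den * c.den * d.den : ℤ) * b.num : ℤ) := by push_cast; rw [← hN b]; ring
  have hC : (14 * (a.den * b.den * c.den * d.den)) * c =
      14 * ((a.den * b.den * d.den : ℤ) * c.num : ℤ) := by push_cast; rw [← hN c]; ring
  have hD : (14 * (a.den * b.den * c.den * d.den)) * d =
      14 * ((a.den * b.den * c.den : ℤ) * d.num : ℤ) := by push_cast; rw [← hN d]; ring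
  generalize (b.den * c.den * d.den : ℤ) * a.num = A at hA
  generalize (a.den * c.den * d.den : ℤ) * b.num = B at hB
  generalize (a.den * b.den * d.den : ℤ) * c.num = C at hC
  generalize (a.den * b.den * c.den : ℤ) * d.num = D at hD
  refine ⟨14 * A - 14 * B + 14 * D - 14 * C, 28 * B - 28 * D, 98 * D - 14 * C, 28 * C, ?_⟩
  ext <;> simp [hA, hB, hC, hD] <;> ring

theorem span_H_eq_top : Submodule.span ℚ (H : Set QuatAlg) = ⊤ := by
  refine eq_top_iff.2 fun x _ => ?_
  obtain ⟨D, hD, h⟩ := exists_zsmul_mem_H x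
  have hD' : (D : ℚ) ≠ 0 := by exact_mod_cast hD
  have : x = (D : ℚ)⁻¹ • (D • x) := by
    rw [← Int.cast_smul_eq_zsmul ℚ, smul_smul, inv_mul_cancel₀ hD', one_smul]
  rw [this]
  exact Submodule.smul_mem _ _ (Submodule.subset_span h)

theorem isOrder_H : IsOrder H := ⟨.of_basis basisH, span_H_eq_top⟩

theorem exists_zsmul_mem_H_of_finite (O : Subring QuatAlg) [Module.Finite ℤ O] :
    ∃ D : ℤ, D ≠ 0 ∧ ∀ x ∈ O, D • x ∈ H := by
  classical
  obtain ⟨s, hs⟩ := Module.Finite.fg_top (R := ℤ) (M := O)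
  choose D hD hDmem using exists_zsmul_mem_H
  refine ⟨∏ y ∈ s, D y, Finset.prod_ne_zero_iff.2 fun y _ => hD y, fun x hx => ?_⟩
  have hx' : (⟨x, hx⟩ : O) ∈ Submodule.span ℤ (s : Set O) := hs ▸ Submodule.mem_top
  suffices ∀ z : O, z ∈ Submodule.span ℤ (s : Set O) → (∏ y ∈ s, D y) • (z : QuatAlg) ∈ H from
    this _ hx'
  intro z hz
  induction hz using Submodule.span_induction with
  | mem z hz =>
    rw [← Finset.prod_erase_mul s _ hz, mul_smul]
    exact H.zsmul_mem (hDmem z) _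
  | zero => simp [H.zero_mem]
  | add y z _ _ hy hz => simpa [smul_add] using H.add_mem hy hz
  | smul a z _ hz =>
    change (∏ y ∈ s, D y) • a • (z : QuatAlg) ∈ H
    rw [smul_comm]
    exact H.zsmul_mem hz a

/-- Powers of `y` stay in `O`, and one `D` has `D·O ⊆ H`. If `N(y) < 1`, the positive integers `D²
N(y)ⁿ` would tend to 0. -/
theorem one_le_reducedNorm_of_finite (O : Subring QuatAlg) [Module.Finite ℤ O] {y : QuatAlg}
    (hy : y ∈ O) (hpos : 0 < reducedNorm y) : 1 ≤ reducedNorm y := by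
  by_contra! hlt
  obtain ⟨D, hD, h⟩ := exists_zsmul_mem_H_of_finite O
  have hD2 : (0 : ℚ) < (D : ℚ) ^ 2 := by positivity
  obtain ⟨n, hn⟩ := exists_pow_lt_of_lt_one (inv_pos.2 hD2) hlt
  obtain ⟨k, hk⟩ := exists_reducedNorm_eq_natCast (h _ (O.pow_mem hy n))
  rw [reducedNorm_zsmul, reducedNorm_pow] at hk
  have h1 : (D : ℚ) ^ 2 * reducedNorm y ^ n < 1 := by
    calc _ < (D : ℚ) ^ 2 * ((D : ℚ) ^ 2)⁻¹ := mul_lt_mul_of_pos_left hn hD2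
      _ = 1 := mul_inv_cancel₀ hD2.ne'
  have h2 : 0 < (D : ℚ) ^ 2 * reducedNorm y ^ n := mul_pos hD2 (pow_pos hpos n)
  rw [hk] at h1 h2
  norm_cast at h1 h2
  omega

theorem maximal_isOrder_H : Maximal IsOrder H := by
  refine ⟨isOrder_H, fun O hO hle x hx => ?_⟩
  by_contra hxH
  have := hO.1
  obtain ⟨β, hβ, γ, hγ, hpos, hlt⟩ := exists_pos_lt_one hxH
  exact hlt.not_ge (one_le_reducedNorm_of_finite O
    (O.sub_mem (O.mul_mem (hle hβ) hx) (hle hγ)) hpos)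

end QuatAlg

theorem mainTheorem4 :
    Maximal QuatAlg.IsOrder QuatAlg.H ∧ QuatAlg.HasReducedDiscriminant QuatAlg.H 13 ∧
      IsLeftPID QuatAlg.H ∧ IsRightPID QuatAlg.H :=
  ⟨QuatAlg.maximal_isOrder_H, QuatAlg.hasReducedDiscriminant_H, QuatAlg.isLeftPID_H,
    QuatAlg.isRightPID_H⟩
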